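/- Let $(W,S)$ be a Coxeter system with $W$ finite and length function $l$, let $\Gamma$ be an abelian group with a total order $\le$ such that $g\le g'$ implies $g+h\le g'+h$, and let $L\colon W\to\Gamma$ satisfy $L(ww')=L(w)+L(w')$ whenever $l(ww')=l(w)+l(w')$, and $L(s)>0$ for all $s\in S$. Let $R\subseteq\mathbb C$ be a subring containing $2\cos(2\pi/m_{st})$ for all $s,t\in S$, where $m_{st}$ is the order of $st$; let $F$ be the field of fractions of $R$, let $A=R[\Gamma]$ with $R$-basis $\{\varepsilon^g\mid g\in\Gamma\}$, and let $K$ be the field of fractions of $A$. Let $\mathbf H$ be the generic Iwahori–Hecke algebra over $A$: it has an $A$-basis $\{T_w\mid w\in W\}$, $T_1$ is its identity element, and $T_sT_w=T_{sw}$ if $l(sw)>l(w)$, $T_sT_w=T_{sw}+(\varepsilon^{L(s)}-\varepsilon^{-L(s)})T_w$ if $l(sw)<l(w)$. Put $\mathbf H_K=K\otimes_A\mathbf H$ and let $\{E^\lambda_\varepsilon\mid\lambda\in\Lambda\}$ be a complete set of representatives of the isomorphism classes of simple $\mathbf H_K$-modules, $d_\lambda=\dim_K E^\lambda_\varepsilon$.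 Let $\mathbf c_\lambda\in K$ be given by $$\sum_{w\in W}\operatorname{trace}(T_w,E^\lambda_\varepsilon)\operatorname{trace}(T_{w^{-1}},E^\lambda_\varepsilon)=d_\lambda\mathbf c_\lambda,$$ and define $\mathbf a_\lambda\in\Gamma$ and $0\ne f_\lambda\in F$ by the condition that $\mathbf c_\lambda=f_\lambda\varepsilon^{-2\mathbf a_\lambda}+{}$ an $F$-linear combination of terms $\varepsilon^g$ with $g>-2\mathbf a_\lambda$. Let $F[\Gamma_{>0}]$ be the set of $F$-linear combinations of the $\varepsilon^g$ with $g>0$. Every $0\neq x\in K$ can be written as $x=r_x\varepsilon^{g_x}(1+p)/(1+q)$ with unique $0\ne r_x\in F$ and $g_x\in\Gamma$, and some $p,q\in F[\Gamma_{>0}]$. Put $\mathcal O=\{0\}\cup\{x\in K\mid x\ne0,\ g_x\ge0\}$ and $\mathfrak p=\{0\}\cup\{x\in K\mid x\ne 0,\ g_x>0\}$; the constant term of $x\in\mathcal O$ is the unique $r\in F$ with $x-r\in\mathfrak p$. A matrix representation $\rho^\lambda\colon\mathbf H_K\to M_{d_\lambda}(K)$ afforded by $E^\lambda_\varepsilon$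 with respect to some $K$-basis is called balanced if $\varepsilon^{\mathbf a_\lambda}\rho^\lambda_{ij}(T_w)\in\mathcal O$ for all $w,i,j$; then $c^{ij}_{w,\lambda}\in F$ denotes the constant term of $(-1)^{l(w)}\varepsilon^{\mathbf a_\lambda}\rho^\lambda_{ij}(T_w)$. Given a family $\rho=(\rho^\lambda)_{\lambda\in\Lambda}$ of balanced representations, $\rho^\lambda$ being afforded by $E^\lambda_\varepsilon$, put $$\tilde\gamma_{x,y,z}=\sum_{\lambda\in\Lambda}\sum_{1\le i,j,k\le d_\lambda}f_\lambda^{-1}c^{ij}_{x,\lambda}c^{jk}_{y,\lambda}c^{ki}_{z,\lambda},\qquad \tilde n_w=\sum_{\lambda\in\Lambda}\sum_{1\le i\le d_\lambda}f_\lambda^{-1}c^{ii}_{w^{-1},\lambda},$$ and let $\tilde{\mathbf J}$ be the $F$-vector space with basis $\{t_w\mid w\in W\}$, the bilinear product $t_xt_y=\sum_{z\in W}\tilde\gamma_{x,y,z^{-1}}t_z$ and the distinguished element (the identity) $1_{\tilde{\mathbf J}}=\sum_{w:\,\tilde n_w\ne0}\tilde n_wt_w$. **Proposition.** Let $\rho=(\rho^\lambda)_{\lambda\in\Lambda}$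 and $\sigma=(\sigma^\lambda)_{\lambda\in\Lambda}$ be two such families of balanced representations, $\rho^\lambda$ and $\sigma^\lambda$ both being afforded by $E^\lambda_\varepsilon$. Then the structure constants $\tilde\gamma_{x,y,z}$ ($x,y,z\in W$) and the elements $\tilde n_w$ ($w\in W$) are the same for $\rho$ and for $\sigma$. Consequently the ring $\tilde{\mathbf J}$ (its product and its identity element) does not depend on the choice of the balanced representations. -/

import Mathlib

open scoped TensorProduct

/-! ### Weight functions -/

namespace CoxeterSystem

variable {B W : Type*} [Group W] {M : CoxeterMatrix B} (cs : CoxeterSystem M W)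

/-- A weight function on a Coxeter group with values in an additive group. -/
structure WeightFunction (Γ : Type*) [Add Γ] where
  toFun : W → Γ
  map_mul' : ∀ w w' : W, cs.length (w * w') = cs.length w + cs.length w' →
    toFun (w * w') = toFun w + toFun w'

instance (Γ : Type*) [Add Γ] : CoeFun (cs.WeightFunction Γ) (fun _ => W → Γ) :=
  ⟨WeightFunction.toFun⟩

/-! ### The exchange condition

It is needed to see that the operators below define an algebra with a basis indexed by `W`. -/

open Classical in
/-- One step of the action of `W` on `W × ℤ/2` that counts inversions modulo two. -/
noncomputable def invStep (i : B) : Function.End (W × ZMod 2) := fun p =>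
  (cs.simple i * p.1 * cs.simple i, p.2 + if p.1 = cs.simple i then 1 else 0)

open Classical in
theorem prod_invStep (ω : List B) (t : W) (e : ZMod 2) :
    (ω.map cs.invStep).prod (t, e) =
      (cs.wordProd ω * t * (cs.wordProd ω)⁻¹, e + (cs.rightInvSeq ω).count t) := by
  induction ω with
  | nil => simp [Function.End.one_def]
  | cons i ω ih =>
    rw [List.map_cons, List.prod_cons]
    change cs.invStep i ((ω.map cs.invStep).prod (t, e)) = _
    rw [ih]
    simp only [invStep, CoxeterSystem.rightInvSeq, cs.wordProd_cons, List.count_cons]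
    have h : (cs.wordProd ω * t * (cs.wordProd ω)⁻¹ = cs.simple i) ↔
        ((cs.wordProd ω)⁻¹ * cs.simple i * cs.wordProd ω = t) := by
      constructor
      · intro h; rw [← h]; group
      · intro h; rw [← h]; group
    refine Prod.ext ?_ ?_
    · simp [mul_assoc]
    · by_cases h' : (cs.wordProd ω)⁻¹ * cs.simple i * cs.wordProd ω = t
      · simp only [if_pos (h.2 h'), beq_iff_eq, if_pos h']
        push_cast; ring
      · simp only [if_neg (fun hh => h' (h.1 hh)), beq_iff_eq, if_neg h']
        push_cast; ring

theorem prod_reverse_alternatingWord {G : Type*} [Monoid G] (f : B → G) (i j : B) (m : ℕ) :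
    ((alternatingWord i j (2 * m)).reverse.map f).prod = (f j * f i) ^ m := by
  induction m with
  | zero => simp [alternatingWord]
  | succ m ih =>
    have : alternatingWord i j (2 * (m + 1)) = alternatingWord i j (2 * m) ++ [i, j] := by
      rw [show 2 * (m + 1) = 2 * m + 1 + 1 by ring, alternatingWord_succ, alternatingWord_succ]
      simp
    rw [this, pow_succ', ← ih]
    simp [mul_assoc]

open Classical in
theorem count_leftInvSeq_alternatingWord (i j : B) (t : W) :
    (((cs.leftInvSeq (alternatingWord j i (2 * M i j))).count t : ℕ) : ZMod 2) = 0 := by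
  set m := M i j with hm
  set f : ℕ → W := fun k => cs.simple j * (cs.simple i * cs.simple j) ^ k with hf
  have h1 : cs.leftInvSeq (alternatingWord j i (2 * m)) = (List.range (2 * m)).map f := by
    apply List.ext_getElem
    · simp
    · intro k hk _
      have hk' : k < 2 * m := by simpa using hk
      rw [cs.getElem_leftInvSeq_alternatingWord j i m k hk',
        cs.prod_alternatingWord_eq_mul_pow]
      have h2 : ¬ Even (2 * k + 1) := by simp
      have h3 : (2 * k + 1) / 2 = k := by omega
      simp [h2, h3, hf]
  have h2 : (List.range (2 * m)).map f = (List.range m).map f ++ (List.range m).map f := by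
    rw [two_mul, List.range_add, List.map_append, List.map_map]
    congr 1
    apply List.map_congr_left
    intro k _
    simp [hf, pow_add, hm]
  rw [h1, h2, List.count_append, Nat.cast_add]
  exact CharTwo.add_self_eq_zero _

theorem isLiftable_invStep : M.IsLiftable cs.invStep := by
  classical
  intro i j
  rw [← prod_reverse_alternatingWord]
  funext p
  obtain ⟨t, e⟩ := p
  have h : cs.wordProd (alternatingWord j i (2 * M i j)).reverse = 1 := by
    rw [wordProd, prod_reverse_alternatingWord, cs.simple_mul_simple_pow]
  rw [prod_invStep, h, cs.rightInvSeq_reverse, List.count_reverse,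
    count_leftInvSeq_alternatingWord]
  simp [Function.End.one_def]

open Classical in
/-- The parity of the number of occurrences of `t` in a right inversion sequence depends only on
the group element. -/
theorem count_rightInvSeq_congr {ω ω' : List B} (h : cs.wordProd ω = cs.wordProd ω') (t : W) :
    (((cs.rightInvSeq ω).count t : ℕ) : ZMod 2) = (cs.rightInvSeq ω').count t := by
  have key : ∀ ω : List B, (ω.map cs.invStep).prod =
      cs.lift ⟨cs.invStep, cs.isLiftable_invStep⟩ (cs.wordProd ω) := by
    intro ω
    rw [wordProd, map_list_prod, List.map_map]
    congr 1
    apply List.map_congr_left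
    intro i _
    simp
  have h1 := congrFun ((key ω).trans ((congrArg _ h).trans (key ω').symm)) (t, 0)
  rw [prod_invStep, prod_invStep] at h1
  simpa using congrArg Prod.snd h1

theorem mem_rightInvSeq_of_isRightDescent {ω : List B} {i : B}
    (h : cs.IsRightDescent (cs.wordProd ω) i) : cs.simple i ∈ cs.rightInvSeq ω := by
  classical
  obtain ⟨ω', hω', hw⟩ := cs.exists_isReduced (cs.wordProd ω * cs.simple i)
  have hn : cs.simple i ∉ cs.rightInvSeq ω' := by
    intro hmem
    have := (cs.isRightInversion_of_mem_rightInvSeq hω' hmem).2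
    rw [← hw] at this
    rw [IsRightDescent] at h
    simp at this
    omega
  have h1 : cs.wordProd ω = cs.wordProd (ω'.concat i) := by
    rw [wordProd_concat, ← hw]; simp
  have h2 := cs.count_rightInvSeq_congr h1 (cs.simple i)
  have h3 : (List.map (MulAut.conj (cs.simple i)) (cs.rightInvSeq ω')).count (cs.simple i) = 0 := by
    rw [List.count_eq_zero]
    intro hmem
    obtain ⟨u, hu, hu'⟩ := List.mem_map.1 hmem
    apply hn
    have : u = cs.simple i := by
      rw [MulAut.conj_apply, mul_inv_eq_iff_eq_mul] at hu'
      exact mul_left_cancel hu'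
    rwa [← this]
  rw [rightInvSeq_concat, List.concat_eq_append, List.count_append, h3] at h2
  simp at h2
  by_contra hcon
  rw [List.count_eq_zero.2 hcon] at h2
  simp at h2

/-- If `s w > w`, `w t > w` and `s w t < s w`, then `s w = w t`. -/
theorem simple_mul_eq_mul_simple {w : W} {i j : B}
    (hi : cs.length w < cs.length (cs.simple i * w))
    (hj : cs.length w < cs.length (w * cs.simple j))
    (hij : cs.length (cs.simple i * w * cs.simple j) < cs.length (cs.simple i * w)) :
    cs.simple i * w = w * cs.simple j := by
  obtain ⟨ω, hω, rfl⟩ := cs.exists_isReduced w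
  have h : cs.simple j ∈ cs.rightInvSeq (i :: ω) :=
    cs.mem_rightInvSeq_of_isRightDescent (by rwa [IsRightDescent, wordProd_cons])
  rw [rightInvSeq, List.mem_cons] at h
  rcases h with h | h
  · rw [h]; group
  · exact absurd (cs.isRightInversion_of_mem_rightInvSeq hω h).2 (by omega)

/-! ### The Iwahori–Hecke algebra

Over a commutative ring `k` with parameters `q i`, it is the algebra with basis `T w` (`w ∈ W`),
with `T 1 = 1`, and `T s * T w = T (s w)` if `l (s w) > l w` and
`T s * T w = T (s w) + q s • T w` if `l (s w) < l w`.  It is realised as an algebra of operators on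
the free module on `W`, namely the one generated by the operators of multiplication by `T s` from
the left. -/

section Hecke

variable {k : Type*} [CommRing k] (q : B → k)

open Classical in
/-- The operator of left multiplication by `T s` on the free module on `W`. -/
noncomputable def leftOp (i : B) : Module.End k (W →₀ k) :=
  Finsupp.linearCombination k fun w =>
    Finsupp.single (cs.simple i * w) 1 +
      if cs.length (cs.simple i * w) < cs.length w then q i • Finsupp.single w 1 else 0

open Classical in
/-- The operator of right multiplication by `T s` on the free module on `W`. -/
noncomputable def rightOp (i : B) : Module.End k (W →₀ k) :=
  Finsupp.linearCombination k fun w =>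
    Finsupp.single (w * cs.simple i) 1 +
      if cs.length (w * cs.simple i) < cs.length w then q i • Finsupp.single w 1 else 0

open Classical in
theorem leftOp_single (i : B) (w : W) : cs.leftOp q i (Finsupp.single w 1) =
    Finsupp.single (cs.simple i * w) 1 +
      if cs.length (cs.simple i * w) < cs.length w then q i • Finsupp.single w 1 else 0 := by
  simp [leftOp]

open Classical in
theorem rightOp_single (i : B) (w : W) : cs.rightOp q i (Finsupp.single w 1) =
    Finsupp.single (w * cs.simple i) 1 +
      if cs.length (w * cs.simple i) < cs.length w then q i • Finsupp.single w 1 else 0 := by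
  simp [rightOp]

/-- The parameters are constant on conjugacy classes of simple reflections. -/
def IsClassFunction : Prop :=
  ∀ (i j : B) (w : W), cs.simple i * w = w * cs.simple j → q i = q j

theorem leftOp_rightOp (hq : cs.IsClassFunction q) (i j : B) (x : W →₀ k) :
    cs.leftOp q i (cs.rightOp q j x) = cs.rightOp q j (cs.leftOp q i x) := by
  classical
  rw [← LinearMap.comp_apply, ← LinearMap.comp_apply]
  congr 1
  apply Finsupp.lhom_ext'
  intro w
  ext1
  simp only [LinearMap.comp_apply, Finsupp.lsingle_apply, leftOp_single, rightOp_single, map_add,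
    apply_ite, map_smul, map_zero, mul_assoc]
  have ha := cs.length_simple_mul w i
  have hb := cs.length_mul_simple w j
  have hc := cs.length_simple_mul (w * cs.simple j) i
  have hd := cs.length_mul_simple (cs.simple i * w) j
  rw [mul_assoc] at hd
  have hE1 : cs.length w < cs.length (cs.simple i * w) →
      cs.length w < cs.length (w * cs.simple j) →
      cs.length (cs.simple i * (w * cs.simple j)) < cs.length (cs.simple i * w) →
      cs.simple i * w = w * cs.simple j := by
    intro h1 h2 h3
    exact cs.simple_mul_eq_mul_simple h1 h2 (by rwa [mul_assoc])
  have hE2 : cs.length (cs.simple i * w) < cs.length w →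
      cs.length (cs.simple i * w) < cs.length (cs.simple i * (w * cs.simple j)) →
      cs.length (w * cs.simple j) < cs.length w →
      cs.simple i * w = w * cs.simple j := by
    intro h1 h2 h3
    have := cs.simple_mul_eq_mul_simple (w := cs.simple i * w) (i := i) (j := j)
      (by simpa using h1) (by rwa [mul_assoc]) (by simpa using h3)
    rw [cs.simple_mul_simple_cancel_left] at this
    conv_rhs => rw [this]
    simp
  by_cases h1 : cs.length (cs.simple i * w) < cs.length w <;>
  by_cases h2 : cs.length (w * cs.simple j) < cs.length w <;>
  by_cases h3 : cs.length (cs.simple i * (w * cs.simple j)) < cs.length (w * cs.simple j) <;>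
  by_cases h4 : cs.length (cs.simple i * (w * cs.simple j)) < cs.length (cs.simple i * w) <;>
  simp only [h1, h2, h3, h4, if_true, if_false] <;>
  try (exfalso; omega)
  · module
  · have e := hE2 (by omega) (by omega) (by omega)
    rw [e, hq i j w e]
  · module
  · module
  · have e := hE1 (by omega) (by omega) (by omega)
    rw [e, hq i j w e]

/-- The Iwahori–Hecke algebra with parameters `q`. -/
noncomputable def heckeAlgebra : Subalgebra k (Module.End k (W →₀ k)) :=
  Algebra.adjoin k (Set.range (cs.leftOp q))

noncomputable instance : Ring (cs.heckeAlgebra q) := Algebra.semiringToRing k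

/-- Evaluation at the basis vector of the identity. -/
noncomputable def heckeEval : cs.heckeAlgebra q →ₗ[k] (W →₀ k) :=
  (LinearMap.applyₗ (Finsupp.single (1 : W) (1 : k))).comp (cs.heckeAlgebra q).val.toLinearMap

theorem heckeEval_apply (h : cs.heckeAlgebra q) :
    cs.heckeEval q h = (h : Module.End k (W →₀ k)) (Finsupp.single 1 1) := rfl

/-- The generator of the Iwahori–Hecke algebra that corresponds to a simple reflection. -/
noncomputable def heckeGen (i : B) : cs.heckeAlgebra q :=
  ⟨cs.leftOp q i, Algebra.subset_adjoin ⟨i, rfl⟩⟩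

theorem heckeEval_gen_mul (i : B) (h : cs.heckeAlgebra q) :
    cs.heckeEval q (cs.heckeGen q i * h) = cs.leftOp q i (cs.heckeEval q h) := rfl

theorem heckeEval_surjective : Function.Surjective (cs.heckeEval q) := by
  classical
  rw [← LinearMap.range_eq_top, eq_top_iff, ← Finsupp.basisSingleOne.span_eq,
    Submodule.span_le]
  rintro _ ⟨w, rfl⟩
  rw [Finsupp.coe_basisSingleOne]
  induction hn : cs.length w using Nat.strong_induction_on generalizing w with
  | _ n ih =>
    by_cases hw : w = 1
    · exact ⟨1, by rw [hw]; rfl⟩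
    · obtain ⟨i, hi⟩ := cs.exists_leftDescent_of_ne_one hw
      rw [IsLeftDescent] at hi
      obtain ⟨h, hh⟩ := ih _ (hn ▸ hi) (cs.simple i * w) rfl
      refine ⟨cs.heckeGen q i * h, ?_⟩
      rw [heckeEval_gen_mul, hh, leftOp_single, cs.simple_mul_simple_cancel_left,
        if_neg (by omega), add_zero]

theorem rightOp_commute (hq : cs.IsClassFunction q) (h : cs.heckeAlgebra q) (j : B)
    (x : W →₀ k) : (h : Module.End k (W →₀ k)) (cs.rightOp q j x) =
      cs.rightOp q j ((h : Module.End k (W →₀ k)) x) := by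
  obtain ⟨h, hh⟩ := h
  change h _ = cs.rightOp q j (h x)
  induction hh using Algebra.adjoin_induction generalizing x with
  | mem y hy => obtain ⟨i, rfl⟩ := hy; exact cs.leftOp_rightOp q hq i j x
  | algebraMap r => simp [Module.algebraMap_end_apply]
  | add a b _ _ ha hb => simp [ha, hb]
  | mul a b _ _ ha hb => simp [ha, hb]

theorem heckeEval_injective (hq : cs.IsClassFunction q) :
    Function.Injective (cs.heckeEval q) := by
  classical
  rw [← LinearMap.ker_eq_bot, LinearMap.ker_eq_bot']
  intro h h0
  apply Subtype.ext
  refine Finsupp.lhom_ext' fun w => LinearMap.ext_ring ?_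
  change (h : Module.End k (W →₀ k)) (Finsupp.single w 1) = 0
  induction hn : cs.length w using Nat.strong_induction_on generalizing w with
  | _ n ih =>
    by_cases hw : w = 1
    · rw [hw]; exact h0
    · obtain ⟨i, hi⟩ := cs.exists_rightDescent_of_ne_one hw
      rw [IsRightDescent] at hi
      have h1 := ih _ (hn ▸ hi) (w * cs.simple i) rfl
      have h2 : Finsupp.single w (1 : k) =
          cs.rightOp q i (Finsupp.single (w * cs.simple i) 1) := by
        rw [rightOp_single, cs.simple_mul_simple_cancel_right, if_neg (by omega), add_zero]
      rw [h2, rightOp_commute _ _ hq, h1, map_zero]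

/-- The standard basis of the Iwahori–Hecke algebra. -/
noncomputable def heckeBasis (hq : cs.IsClassFunction q) :
    Module.Basis W k (cs.heckeAlgebra q) :=
  Module.Basis.ofRepr (LinearEquiv.ofBijective (cs.heckeEval q)
    ⟨cs.heckeEval_injective q hq, cs.heckeEval_surjective q⟩)

theorem heckeEval_basis (hq : cs.IsClassFunction q) (w : W) :
    cs.heckeEval q (cs.heckeBasis q hq w) = Finsupp.single w 1 :=
  (cs.heckeBasis q hq).repr_self w

theorem heckeBasis_one (hq : cs.IsClassFunction q) : cs.heckeBasis q hq 1 = 1 := by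
  apply cs.heckeEval_injective q hq
  rw [heckeEval_basis]; rfl

theorem heckeBasis_simple (hq : cs.IsClassFunction q) (i : B) :
    cs.heckeBasis q hq (cs.simple i) = cs.heckeGen q i := by
  apply cs.heckeEval_injective q hq
  rw [heckeEval_basis, ← mul_one (cs.heckeGen q i), ← cs.heckeBasis_one q hq, heckeEval_gen_mul,
    heckeEval_basis, leftOp_single]
  simp

open Classical in
/-- The multiplication rule of the Iwahori–Hecke algebra. -/
theorem heckeBasis_simple_mul (hq : cs.IsClassFunction q) (i : B) (w : W) :
    cs.heckeBasis q hq (cs.simple i) * cs.heckeBasis q hq w =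
      if cs.length w < cs.length (cs.simple i * w) then cs.heckeBasis q hq (cs.simple i * w)
      else cs.heckeBasis q hq (cs.simple i * w) + q i • cs.heckeBasis q hq w := by
  have := cs.length_simple_mul w i
  apply cs.heckeEval_injective q hq
  rw [heckeBasis_simple, heckeEval_gen_mul, heckeEval_basis, leftOp_single]
  split_ifs
  · omega
  · simp [heckeEval_basis]
  · simp [heckeEval_basis]
  · omega

end Hecke

/-- A weight function takes the same value on conjugate simple reflections. -/
theorem WeightFunction.apply_simple_eq {Γ : Type*} [AddCommGroup Γ] (L : cs.WeightFunction Γ)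
    (i j : B) (w : W) (h : cs.simple i * w = w * cs.simple j) :
    L (cs.simple i) = L (cs.simple j) := by
  have key : ∀ w : W, cs.simple i * w = w * cs.simple j →
      cs.length w < cs.length (cs.simple i * w) → L (cs.simple i) = L (cs.simple j) := by
    intro w h hlt
    have hl := cs.length_simple_mul w i
    have h1 := L.map_mul' (cs.simple i) w (by rw [cs.length_simple]; omega)
    have h2 := L.map_mul' w (cs.simple j) (by rw [← h, cs.length_simple]; omega)
    rw [h, h2, add_comm] at h1
    exact (add_right_cancel h1).symm
  rcases cs.length_simple_mul w i with hl | hl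
  · exact key w h (by omega)
  · refine key (cs.simple i * w) ?_ ?_
    · rw [cs.simple_mul_simple_cancel_left, h, cs.simple_mul_simple_cancel_right]
    · rw [cs.simple_mul_simple_cancel_left]; omega

end CoxeterSystem

/-! ### Leading matrix coefficients -/

namespace LeadingCoefficients

/-- The field of fractions `F` of `R`. -/
abbrev ScalarField (R : Subring ℂ) : Type := FractionRing R

/-- The group ring `A = R[Γ]`. -/
abbrev LaurentRing (R : Subring ℂ) (Γ : Type*) := AddMonoidAlgebra R Γ

section Parameters

variable {B W : Type*} [Group W] {M : CoxeterMatrix B} {cs : CoxeterSystem M W}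
  (R : Subring ℂ) {Γ : Type*} [AddCommGroup Γ] (L : cs.WeightFunction Γ)

/-- The parameters `v_s - v_s⁻¹`, where `v_s = ε ^ (L s)`. -/
noncomputable def parameter (i : B) : LaurentRing R Γ :=
  AddMonoidAlgebra.single (L (cs.simple i)) 1 - AddMonoidAlgebra.single (-L (cs.simple i)) 1

theorem isClassFunction_parameter : cs.IsClassFunction (parameter R L) := by
  intro i j w h
  rw [parameter, parameter, CoxeterSystem.WeightFunction.apply_simple_eq cs L i j w h]

end Parameters

section Valuation

variable (R : Subring ℂ) {Γ : Type*} [AddCommGroup Γ] [LinearOrder Γ] [IsOrderedAddMonoid Γ]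

variable (Γ) in
/-- The field of fractions `K` of `A = R[Γ]`. -/
abbrev LaurentField := FractionRing (LaurentRing R Γ)

noncomputable instance : Algebra (ScalarField R) (LaurentField R Γ) :=
  FractionRing.liftAlgebra R (LaurentField R Γ)

/-- The element `ε ^ g` of `K`. -/
noncomputable def eps (g : Γ) : LaurentField R Γ :=
  algebraMap (LaurentRing R Γ) (LaurentField R Γ) (AddMonoidAlgebra.single g 1)

/-- The set of `F`-linear combinations of the `ε ^ g` with `g > c`. -/
noncomputable def combinationsAbove (c : Γ) : Submodule (ScalarField R) (LaurentField R Γ) :=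
  Submodule.span (ScalarField R) (eps R '' Set.Ioi c)

/-- `x = r ε ^ g (1 + p) / (1 + q)` with `p` and `q` in `F[Γ_{>0}]`. -/
def HasExpansion (x : LaurentField R Γ) (r : ScalarField R) (g : Γ) : Prop :=
  ∃ p ∈ combinationsAbove R (0 : Γ), ∃ q ∈ combinationsAbove R (0 : Γ),
    x = algebraMap (ScalarField R) (LaurentField R Γ) r * eps R g * ((1 + p) / (1 + q))

variable (Γ) in
/-- The valuation ring `𝒪` of `K` (`x = 0` is the case `r = 0`). -/
def integers : Set (LaurentField R Γ) :=
  {x | ∃ (r : ScalarField R) (g : Γ), 0 ≤ g ∧ HasExpansion R x r g}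

variable (Γ) in
/-- The maximal ideal `𝔭` of `𝒪`. -/
def maximalIdeal : Set (LaurentField R Γ) :=
  {x | x = 0 ∨ ∃ (r : ScalarField R) (g : Γ), 0 < g ∧ HasExpansion R x r g}

open Classical in
/-- The constant term of `x ∈ 𝒪`: the unique `r ∈ F` with `x - r ∈ 𝔭`. -/
noncomputable def constantTerm (x : LaurentField R Γ) : ScalarField R :=
  if h : ∃ r : ScalarField R,
      x - algebraMap (ScalarField R) (LaurentField R Γ) r ∈ maximalIdeal R Γ
  then h.choose else 0

end Valuation

section Representations

universe u v w

variable {B : Type*} {W : Type u} [Group W] {M : CoxeterMatrix B} {cs : CoxeterSystem M W}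
  (R : Subring ℂ) {Γ : Type v} [AddCommGroup Γ] [LinearOrder Γ] [IsOrderedAddMonoid Γ]
  (L : cs.WeightFunction Γ)

/-- The generic Iwahori–Hecke algebra over `A`. -/
noncomputable abbrev GenericHecke := cs.heckeAlgebra (parameter R L)

/-- The generic Iwahori–Hecke algebra with scalars extended to `K`. -/
abbrev HeckeK := LaurentField R Γ ⊗[LaurentRing R Γ] GenericHecke R L

/-- The basis element `T w` of the Iwahori–Hecke algebra over `K`. -/
noncomputable def T (w : W) : HeckeK R L :=
  1 ⊗ₜ[LaurentRing R Γ] cs.heckeBasis (parameter R L) (isClassFunction_parameter R L) w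

/-- `E` is a complete set of representatives of the isomorphism classes of simple modules of the
Iwahori–Hecke algebra over `K`. -/
structure IsIrr {Λ : Type*} (E : Λ → Type w) [∀ l, AddCommGroup (E l)]
    [∀ l, Module (HeckeK R L) (E l)] : Prop where
  simple : ∀ l, IsSimpleModule (HeckeK R L) (E l)
  injective : ∀ l m, Nonempty (E l ≃ₗ[HeckeK R L] E m) → l = m
  exhaustive : ∀ (V : Type (max u v)) [AddCommGroup V] [Module (HeckeK R L) V],
    IsSimpleModule (HeckeK R L) V → ∃ l, Nonempty (V ≃ₗ[HeckeK R L] E l)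

section Single

variable (E : Type w) [AddCommGroup E] [Module (LaurentField R Γ) E] [Module (HeckeK R L) E]
  [IsScalarTower (LaurentField R Γ) (HeckeK R L) E]

/-- The action of an element of the Iwahori–Hecke algebra on a module. -/
noncomputable def action (h : HeckeK R L) : E →ₗ[LaurentField R Γ] E :=
  Algebra.lsmul (LaurentField R Γ) (LaurentField R Γ) E h

/-- The dimension over `K` of a module. -/
noncomputable def dim : ℕ := Module.finrank (LaurentField R Γ) E

/-- The element `𝒄` of `K` determined by `∑ w, trace (T w) * trace (T w⁻¹) = dim * 𝒄`. -/
noncomputable def schurElement [Fintype W] : LaurentField R Γ :=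
  (∑ w : W, LinearMap.trace _ _ (action R L E (T R L w)) *
    LinearMap.trace _ _ (action R L E (T R L w⁻¹))) / (dim R (Γ := Γ) E : LaurentField R Γ)

/-- `𝒄 = f ε ^ (-2 a) +` a combination of terms `ε ^ g` with `g > -2 a`, where `f ≠ 0`. -/
def IsLeadingData [Fintype W] (d : Γ × ScalarField R) : Prop :=
  d.2 ≠ 0 ∧ schurElement R L E -
    algebraMap (ScalarField R) (LaurentField R Γ) d.2 * eps R (-(2 • d.1)) ∈
      combinationsAbove R (-(2 • d.1))

open Classical in
/-- The pair `(𝒂, f)` that is determined by the element `𝒄`. -/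
noncomputable def leadingData [Fintype W] : Γ × ScalarField R :=
  if h : ∃ d, IsLeadingData R L E d then h.choose else (0, 0)

/-- The invariant `𝒂`. -/
noncomputable def aInvariant [Fintype W] : Γ := (leadingData R L E).1

/-- The invariant `f`. -/
noncomputable def fInvariant [Fintype W] : ScalarField R := (leadingData R L E).2

/-- Matrix representations over `K` of the degree of `E`. -/
abbrev MatrixRep :=
  HeckeK R L →ₐ[LaurentField R Γ]
    Matrix (Fin (dim R (Γ := Γ) E)) (Fin (dim R (Γ := Γ) E)) (LaurentField R Γ)

variable {E}

/-- The matrix representation `ρ` is afforded by `E` with respect to some basis. -/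
def IsAfforded (ρ : MatrixRep R L E) : Prop :=
  ∃ b : Module.Basis (Fin (dim R (Γ := Γ) E)) (LaurentField R Γ) E,
    ∀ h, ρ h = LinearMap.toMatrix b b (action R L E h)

/-- Balanced matrix representations. -/
def IsBalanced [Fintype W] (ρ : MatrixRep R L E) : Prop :=
  ∀ w i j, eps R (aInvariant R L E) * ρ (T R L w) i j ∈ integers R Γ

/-- The leading matrix coefficient `c_w^{ij}`. -/
noncomputable def leadingCoeff [Fintype W] (ρ : MatrixRep R L E) (w : W)
    (i j : Fin (dim R (Γ := Γ) E)) : ScalarField R :=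
  constantTerm R ((-1) ^ cs.length w * eps R (aInvariant R L E) * ρ (T R L w) i j)

end Single

section Family

variable [Fintype W] {Λ : Type*} [Fintype Λ] {E : Λ → Type w} [∀ l, AddCommGroup (E l)]
  [∀ l, Module (LaurentField R Γ) (E l)] [∀ l, Module (HeckeK R L) (E l)]
  [∀ l, IsScalarTower (LaurentField R Γ) (HeckeK R L) (E l)]
  (ρ : ∀ l, MatrixRep R L (E l))

/-- The structure constant `γ̃_{x,y,z}`. -/
noncomputable def gammaTilde (x y z : W) : ScalarField R :=
  ∑ l, ∑ i, ∑ j, ∑ k, (fInvariant R L (E l))⁻¹ * leadingCoeff R L (ρ l) x i j *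
    leadingCoeff R L (ρ l) y j k * leadingCoeff R L (ρ l) z k i

/-- The coefficient `ñ_w`. -/
noncomputable def nTilde (w : W) : ScalarField R :=
  ∑ l, ∑ i, (fInvariant R L (E l))⁻¹ * leadingCoeff R L (ρ l) w⁻¹ i i

/-- A bilinear product and a distinguished element on the vector space with basis `W`. -/
structure BasedAlgebra (F W : Type*) [Field F] where
  mul : (W →₀ F) →ₗ[F] (W →₀ F) →ₗ[F] (W →₀ F)
  one : W →₀ F

open Classical in
/-- The ring `J̃` on the vector space over `F` with basis `t w = Finsupp.single w 1`: the product
is given by `t x * t y = ∑ z, γ̃_{x,y,z⁻¹} t z`, and the identity element is the sum of the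
`ñ_w t w` over the set `𝒟̃` of all `w` with `ñ_w ≠ 0`. -/
noncomputable def jTilde : BasedAlgebra (ScalarField R) W where
  mul := Finsupp.linearCombination _ fun x => Finsupp.linearCombination _ fun y =>
    ∑ z, gammaTilde R L ρ x y z⁻¹ • Finsupp.single z 1
  one := ∑ w with nTilde R L ρ w ≠ 0, nTilde R L ρ w • Finsupp.single w 1

end Family

end Representations

end LeadingCoefficients

/-! A change of basis alters the individual leading coefficients, but `gammaTilde` and `nTilde`
contain them only in the combinations of a trace. Taking constant terms respects sums and products
on the valuation ring `integers R Γ`. Hence, for each `λ`, the sum of `c_x^{ij} c_y^{jk} c_z^{ki}`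
over `i, j, k` is the constant term of `± ε ^ (3 𝒂) trace (T x * T y * T z)`, and the sum of the
`c_w^{ii}` is that of `± ε ^ 𝒂 trace (T w)`. The sign, `𝒂` and `f` depend only on the group elements
and on the module, and the trace does not see the basis. So the two families agree already for each
`λ` separately.

The work lies in the constant term. It is handled through fractions `(r + a) / (1 + b)` with `a, b ∈
F[Γ_{>0}]`: sums and products of such fractions have the same shape because `F[Γ_{>0}]` is closed
under multiplication, and `r` is unique because the `ε ^ g` are linearly independent over `F`. The
lemmas that carry the argument are `HasConstantTerm.unique`, `IsAfforded.trace_eq` and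
`hasConstantTerm_trace_mul_mul`. -/

namespace LeadingCoefficients

/-! ### Monomials, combinations of positive monomials, and constant terms -/

section ConstantTerm

variable (R : Subring ℂ) {Γ : Type*} [AddCommGroup Γ]

theorem eps_zero : eps R (0 : Γ) = 1 := by
  rw [eps, ← AddMonoidAlgebra.one_def, map_one]

theorem eps_add (g h : Γ) : eps R (g + h) = eps R g * eps R h := by
  simp only [eps]
  rw [← map_mul, AddMonoidAlgebra.single_mul_single, one_mul]

variable [LinearOrder Γ] [IsOrderedAddMonoid Γ]

/-- Over `R` this is the injectivity of `R[Γ] → K`; clearing denominators gives independence over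
the fraction field of `R`. -/
theorem linearIndependent_eps :
    LinearIndependent (ScalarField R) (eps R : Γ → LaurentField R Γ) := by
  have : IsScalarTower R (ScalarField R) (LaurentField R Γ) :=
    FractionRing.isScalarTower_liftAlgebra R (LaurentField R Γ)
  rw [← LinearIndependent.iff_fractionRing R (ScalarField R), linearIndependent_iff]
  intro c hc
  have h : algebraMap (LaurentRing R Γ) (LaurentField R Γ) (AddMonoidAlgebra.ofCoeff c) = 0 := by
    rw [← hc, Finsupp.linearCombination_apply, ← AddMonoidAlgebra.sum_coeff_single
      (AddMonoidAlgebra.ofCoeff c), AddMonoidAlgebra.coeff_ofCoeff, Finsupp.sum, Finsupp.sum,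
      map_sum]
    refine Finset.sum_congr rfl fun g _ => ?_
    rw [eps, ← algebraMap.coe_smul, AddMonoidAlgebra.smul_single, smul_eq_mul, mul_one]
  rw [map_eq_zero_iff _ (IsFractionRing.injective (LaurentRing R Γ) (LaurentField R Γ)),
    AddMonoidAlgebra.ofCoeff_eq_zero] at h
  exact h

variable {R}

theorem combinationsAbove_mul {x y : LaurentField R Γ} (hx : x ∈ combinationsAbove R (0 : Γ))
    (hy : y ∈ combinationsAbove R (0 : Γ)) : x * y ∈ combinationsAbove R (0 : Γ) := by
  have h := Submodule.mul_mem_mul hx hy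
  rw [combinationsAbove, Submodule.span_mul_span] at h
  refine Submodule.span_mono ?_ h
  rintro _ ⟨_, ⟨g, hg, rfl⟩, _, ⟨k, hk, rfl⟩, rfl⟩
  exact ⟨g + k, add_pos hg hk, eps_add R g k⟩

theorem algebraMap_mul_mem {x : LaurentField R Γ} (r : ScalarField R)
    (hx : x ∈ combinationsAbove R (0 : Γ)) :
    algebraMap (ScalarField R) (LaurentField R Γ) r * x ∈ combinationsAbove R (0 : Γ) := by
  rw [← Algebra.smul_def]
  exact Submodule.smul_mem _ r hx

theorem eps_mem {g : Γ} (hg : 0 < g) : eps R g ∈ combinationsAbove R (0 : Γ) :=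
  Submodule.subset_span ⟨g, hg, rfl⟩

/-- A nonzero constant would put `1 = ε ^ 0` into the span of the `ε ^ g` with `g > 0`, against
linear independence. Both the nonvanishing of denominators and the uniqueness of constant terms rest
on this. -/
theorem eq_zero_of_algebraMap_mem {r : ScalarField R}
    (h : algebraMap (ScalarField R) (LaurentField R Γ) r ∈ combinationsAbove R (0 : Γ)) :
    r = 0 := by
  by_contra hr
  have h1 : eps R (0 : Γ) ∈ combinationsAbove R (0 : Γ) := by
    have := Submodule.smul_mem _ r⁻¹ h
    rwa [Algebra.smul_def, ← map_mul, inv_mul_cancel₀ hr, map_one, ← eps_zero] at this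
  exact (linearIndependent_eps R).notMem_span_image (s := Set.Ioi (0 : Γ)) (lt_irrefl _) h1

theorem one_add_ne_zero {q : LaurentField R Γ} (hq : q ∈ combinationsAbove R (0 : Γ)) :
    1 + q ≠ 0 := by
  intro h
  have h1 : algebraMap (ScalarField R) (LaurentField R Γ) (-1) = q := by
    rw [map_neg, map_one]; linear_combination -h
  have := eq_zero_of_algebraMap_mem (h1 ▸ hq)
  simp at this

/-- A nonzero combination of the `ε ^ g` with `g > 0` has a leading term. -/
theorem exists_leadingTerm {x : LaurentField R Γ} (hx : x ∈ combinationsAbove R (0 : Γ))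
    (h0 : x ≠ 0) : ∃ (r : ScalarField R) (g : Γ), 0 < g ∧ ∃ p ∈ combinationsAbove R (0 : Γ),
      x = algebraMap (ScalarField R) (LaurentField R Γ) r * eps R g * (1 + p) := by
  obtain ⟨c, hc, rfl⟩ := (Finsupp.mem_span_image_iff_linearCombination _).1 hx
  have hne : c.support.Nonempty := by
    rw [Finsupp.support_nonempty_iff]
    rintro rfl
    simp at h0
  -- The smallest exponent gives the leading term: dividing by `c g • ε ^ g` leaves `1` and
  -- multiples of `ε ^ (k - g)` with `k > g`.
  set g := c.support.min' hne with hg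
  have hgm : g ∈ c.support := c.support.min'_mem hne
  have hr : c g ≠ 0 := Finsupp.mem_support_iff.1 hgm
  refine ⟨c g, g, hc hgm, ∑ k ∈ c.support.erase g,
    ((c g)⁻¹ * c k) • eps R (k - g), Submodule.sum_mem _ fun k hk => ?_, ?_⟩
  · refine Submodule.smul_mem _ _ (eps_mem (sub_pos.2 ?_))
    exact lt_of_le_of_ne (c.support.min'_le k (Finset.mem_of_mem_erase hk))
      (Finset.ne_of_mem_erase hk).symm
  · rw [Finsupp.linearCombination_apply, Finsupp.sum, ← Finset.add_sum_erase _ _ hgm, mul_add,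
      mul_one, ← Algebra.smul_def, Finset.mul_sum]
    congr 1
    refine Finset.sum_congr rfl fun k _ => ?_
    rw [smul_mul_smul_comm, mul_inv_cancel_left₀ hr, ← eps_add, add_sub_cancel]

variable (R) in
/-- `x = (r + a) / (1 + b)` with `a` and `b` in `F[Γ_{>0}]`. -/
def HasConstantTerm (x : LaurentField R Γ) (r : ScalarField R) : Prop :=
  ∃ a ∈ combinationsAbove R (0 : Γ), ∃ b ∈ combinationsAbove R (0 : Γ),
    x = (algebraMap (ScalarField R) (LaurentField R Γ) r + a) / (1 + b)

/-! ### Arithmetic of constant terms -/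

namespace HasConstantTerm

variable {x y : LaurentField R Γ} {r s : ScalarField R}

theorem add (hx : HasConstantTerm R x r) (hy : HasConstantTerm R y s) :
    HasConstantTerm R (x + y) (r + s) := by
  obtain ⟨a, ha, b, hb, rfl⟩ := hx
  obtain ⟨c, hc, d, hd, rfl⟩ := hy
  have hb' := one_add_ne_zero hb
  have hd' := one_add_ne_zero hd
  -- Over the common denominator `(1 + b) * (1 + d)`, this is the numerator without its constant `r
  -- + s`.
  refine ⟨a + c + algebraMap _ _ r * d + algebraMap _ _ s * b + a * d + c * b, ?_,
    b + d + b * d, ?_, ?_⟩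
  · exact add_mem (add_mem (add_mem (add_mem (add_mem ha hc) (algebraMap_mul_mem r hd))
      (algebraMap_mul_mem s hb)) (combinationsAbove_mul ha hd)) (combinationsAbove_mul hc hb)
  · exact add_mem (add_mem hb hd) (combinationsAbove_mul hb hd)
  · rw [show 1 + (b + d + b * d) = (1 + b) * (1 + d) by ring, div_add_div _ _ hb' hd', map_add]
    congr 1
    ring

theorem mul (hx : HasConstantTerm R x r) (hy : HasConstantTerm R y s) :
    HasConstantTerm R (x * y) (r * s) := by
  obtain ⟨a, ha, b, hb, rfl⟩ := hx
  obtain ⟨c, hc, d, hd, rfl⟩ := hy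
  refine ⟨algebraMap _ _ r * c + algebraMap _ _ s * a + a * c, ?_, b + d + b * d, ?_, ?_⟩
  · exact add_mem (add_mem (algebraMap_mul_mem r hc) (algebraMap_mul_mem s ha))
      (combinationsAbove_mul ha hc)
  · exact add_mem (add_mem hb hd) (combinationsAbove_mul hb hd)
  · rw [div_mul_div_comm, map_mul]
    congr 1 <;> ring

theorem zero : HasConstantTerm R (0 : LaurentField R Γ) 0 :=
  ⟨0, zero_mem _, 0, zero_mem _, by simp⟩

theorem sum {ι : Type*} (s : Finset ι) {f : ι → LaurentField R Γ} {r : ι → ScalarField R}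
    (h : ∀ i ∈ s, HasConstantTerm R (f i) (r i)) :
    HasConstantTerm R (∑ i ∈ s, f i) (∑ i ∈ s, r i) := by
  classical
  induction s using Finset.induction_on with
  | empty => simpa using zero
  | insert i s hi ih =>
    rw [Finset.sum_insert hi, Finset.sum_insert hi]
    exact (h i (Finset.mem_insert_self i s)).add
      (ih fun j hj => h j (Finset.mem_insert_of_mem hj))

/-- Cross-multiplying two such fractions for `x` shows that the constant `r - s` lies in
`F[Γ_{>0}]`. -/
theorem unique (hr : HasConstantTerm R x r) (hs : HasConstantTerm R x s) : r = s := by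
  obtain ⟨a, ha, b, hb, rfl⟩ := hr
  obtain ⟨c, hc, d, hd, h⟩ := hs
  rw [div_eq_div_iff (one_add_ne_zero hb) (one_add_ne_zero hd)] at h
  refine sub_eq_zero.1 (eq_zero_of_algebraMap_mem (Γ := Γ) ?_)
  have : algebraMap (ScalarField R) (LaurentField R Γ) (r - s) =
      c + c * b + algebraMap _ _ s * b - (a + a * d + algebraMap _ _ r * d) := by
    rw [map_sub]; linear_combination h
  rw [this]
  exact sub_mem (add_mem (add_mem hc (combinationsAbove_mul hc hb)) (algebraMap_mul_mem s hb))
    (add_mem (add_mem ha (combinationsAbove_mul ha hd)) (algebraMap_mul_mem r hd))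

end HasConstantTerm

/-- This passes between the multiplicative form `r ε ^ g (1 + p) / (1 + q)`, which is awkward for
sums, and the additive form. The way back needs the leading term of the numerator. -/
theorem mem_maximalIdeal_iff {x : LaurentField R Γ} :
    x ∈ maximalIdeal R Γ ↔ HasConstantTerm R x 0 := by
  constructor
  · rintro (rfl | ⟨r, g, hg, p, hp, q, hq, rfl⟩)
    · exact HasConstantTerm.zero
    · refine ⟨algebraMap _ _ r * (eps R g + eps R g * p), ?_, q, hq, ?_⟩
      · exact algebraMap_mul_mem r (add_mem (eps_mem hg) (combinationsAbove_mul (eps_mem hg) hp))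
      · rw [map_zero]; ring
  · rintro ⟨a, ha, b, hb, rfl⟩
    rw [map_zero, zero_add]
    by_cases h0 : a = 0
    · exact Or.inl (by rw [h0, zero_div])
    · obtain ⟨r, g, hg, p, hp, rfl⟩ := exists_leadingTerm ha h0
      exact Or.inr ⟨r, g, hg, p, hp, b, hb, by rw [mul_div_assoc]⟩

theorem hasConstantTerm_iff {x : LaurentField R Γ} {r : ScalarField R} :
    HasConstantTerm R x r ↔
      x - algebraMap (ScalarField R) (LaurentField R Γ) r ∈ maximalIdeal R Γ := by
  have key : ∀ s : ScalarField R, HasConstantTerm R (algebraMap _ (LaurentField R Γ) s) s :=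
    fun s => ⟨0, zero_mem _, 0, zero_mem _, by simp⟩
  rw [mem_maximalIdeal_iff]
  constructor
  · intro h
    simpa [sub_eq_add_neg] using h.add (key (-r))
  · intro h
    simpa using h.add (key r)

theorem exists_hasConstantTerm {x : LaurentField R Γ} (hx : x ∈ integers R Γ) :
    ∃ r, HasConstantTerm R x r := by
  obtain ⟨r, g, hg, h⟩ := hx
  -- For `g = 0` the leading coefficient is the constant term; for `g > 0` the constant term is `0`.
  rcases hg.eq_or_lt with rfl | hg
  · obtain ⟨p, hp, q, hq, rfl⟩ := h
    refine ⟨r, algebraMap _ _ r * p, algebraMap_mul_mem r hp, q, hq, ?_⟩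
    rw [eps_zero]; ring
  · exact ⟨0, mem_maximalIdeal_iff.1 (Or.inr ⟨r, g, hg, h⟩)⟩

/-- `constantTerm` is a choice with default value `0`; the existence of some constant term rules the
default out. -/
theorem HasConstantTerm.constantTerm {x : LaurentField R Γ} {r : ScalarField R}
    (hx : HasConstantTerm R x r) : HasConstantTerm R x (constantTerm R x) := by
  have h : ∃ r : ScalarField R,
      x - algebraMap (ScalarField R) (LaurentField R Γ) r ∈ maximalIdeal R Γ :=
    ⟨r, hasConstantTerm_iff.1 hx⟩
  rw [LeadingCoefficients.constantTerm, dif_pos h]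
  exact hasConstantTerm_iff.2 h.choose_spec

theorem hasConstantTerm_neg_one_pow (n : ℕ) :
    HasConstantTerm R ((-1) ^ n : LaurentField R Γ) ((-1) ^ n) :=
  ⟨0, zero_mem _, 0, zero_mem _, by simp⟩

end ConstantTerm

/-! ### Characters as traces of matrix representations -/

section Characters

variable {B W : Type*} [Group W] {M : CoxeterMatrix B} {cs : CoxeterSystem M W}
  {R : Subring ℂ} {Γ : Type*} [AddCommGroup Γ]
  {L : cs.WeightFunction Γ} {E : Type*} [AddCommGroup E] [Module (LaurentField R Γ) E]
  [Module (HeckeK R L) E] [IsScalarTower (LaurentField R Γ) (HeckeK R L) E]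
  {ρ : MatrixRep R L E}

/-- The independence of the basis enters here: the right-hand side involves only the module. -/
theorem IsAfforded.trace_eq (hρ : IsAfforded R L ρ) (h : HeckeK R L) :
    (ρ h).trace = LinearMap.trace _ _ (action R L E h) := by
  obtain ⟨b, hb⟩ := hρ
  rw [hb, LinearMap.trace_eq_matrix_trace _ b]

end Characters

section Traces

variable {B W : Type*} [Group W] [Fintype W] {M : CoxeterMatrix B} {cs : CoxeterSystem M W}
  {R : Subring ℂ} {Γ : Type*} [AddCommGroup Γ] [LinearOrder Γ] [IsOrderedAddMonoid Γ]
  {L : cs.WeightFunction Γ} {E : Type*} [AddCommGroup E] [Module (LaurentField R Γ) E]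
  [Module (HeckeK R L) E] [IsScalarTower (LaurentField R Γ) (HeckeK R L) E]
  {ρ : MatrixRep R L E}

theorem IsBalanced.hasConstantTerm (hρ : IsBalanced R L ρ) (w : W)
    (i j : Fin (dim R (Γ := Γ) E)) :
    HasConstantTerm R ((-1) ^ cs.length w * eps R (aInvariant R L E) * ρ (T R L w) i j)
      (leadingCoeff R L ρ w i j) := by
  obtain ⟨r, hr⟩ := exists_hasConstantTerm (hρ w i j)
  -- Balancedness concerns `ε ^ 𝒂 ρ(T w)` without the sign, which is supplied as a factor with
  -- constant term `±1`.
  have h := (hasConstantTerm_neg_one_pow (cs.length w)).mul hr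
  rw [← mul_assoc] at h
  exact h.constantTerm

/-- The trace of a product of three matrices of leading coefficients is the constant term of
a character value. -/
theorem hasConstantTerm_trace_mul_mul (hρ : IsAfforded R L ρ) (hρ' : IsBalanced R L ρ)
    (x y z : W) :
    HasConstantTerm R
      ((-1) ^ cs.length x * (-1) ^ cs.length y * (-1) ^ cs.length z *
        eps R (aInvariant R L E) ^ 3 *
          LinearMap.trace _ _ (action R L E (T R L x * T R L y * T R L z)))
      (∑ i, ∑ j, ∑ k, leadingCoeff R L ρ x i j * leadingCoeff R L ρ y j k *
        leadingCoeff R L ρ z k i) := by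
  have h := HasConstantTerm.sum Finset.univ fun i _ => HasConstantTerm.sum Finset.univ fun j _ =>
    HasConstantTerm.sum Finset.univ fun k _ =>
      ((hρ'.hasConstantTerm x i j).mul (hρ'.hasConstantTerm y j k)).mul
        (hρ'.hasConstantTerm z k i)
  convert h using 1
  rw [← hρ.trace_eq, map_mul, map_mul]
  simp only [Matrix.trace, Matrix.diag, Matrix.mul_apply, Finset.mul_sum, Finset.sum_mul]
  refine Finset.sum_congr rfl fun i _ => ?_
  -- The diagonal entries of `(ρ(T x) * ρ(T y)) * ρ(T z)` expand with the sum over `k` outside the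
  -- sum over `j`.
  rw [Finset.sum_comm]
  refine Finset.sum_congr rfl fun j _ => Finset.sum_congr rfl fun k _ => ?_
  ring

theorem hasConstantTerm_trace (hρ : IsAfforded R L ρ) (hρ' : IsBalanced R L ρ) (w : W) :
    HasConstantTerm R
      ((-1) ^ cs.length w * eps R (aInvariant R L E) *
        LinearMap.trace _ _ (action R L E (T R L w)))
      (∑ i, leadingCoeff R L ρ w i i) := by
  have h := HasConstantTerm.sum Finset.univ fun i _ => hρ'.hasConstantTerm w i i
  convert h using 1
  rw [← hρ.trace_eq, Matrix.trace, Finset.mul_sum]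
  rfl

end Traces

/-! ### Comparison of two balanced families -/

section Families

variable {B W : Type*} [Group W] [Fintype W] {M : CoxeterMatrix B} {cs : CoxeterSystem M W}
  {R : Subring ℂ} {Γ : Type*} [AddCommGroup Γ] [LinearOrder Γ] [IsOrderedAddMonoid Γ]
  {L : cs.WeightFunction Γ} {Λ : Type*} [Fintype Λ] {E : Λ → Type*} [∀ l, AddCommGroup (E l)]
  [∀ l, Module (LaurentField R Γ) (E l)] [∀ l, Module (HeckeK R L) (E l)]
  [∀ l, IsScalarTower (LaurentField R Γ) (HeckeK R L) (E l)]
  {ρ σ : ∀ l, MatrixRep R L (E l)}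

theorem gammaTilde_congr (hρ : ∀ l, IsAfforded R L (ρ l)) (hσ : ∀ l, IsAfforded R L (σ l))
    (hρ' : ∀ l, IsBalanced R L (ρ l)) (hσ' : ∀ l, IsBalanced R L (σ l)) (x y z : W) :
    gammaTilde R L ρ x y z = gammaTilde R L σ x y z := by
  refine Finset.sum_congr rfl fun l _ => ?_
  -- Both triple sums are constant terms of one element of `K`, and the factor `f⁻¹` depends only on
  -- `E l`.
  simpa only [Finset.mul_sum, mul_assoc] using congrArg ((fInvariant R L (E l))⁻¹ * ·) <| (hasConstantTerm_trace_mul_mul (hρ l) (hρ' l) x y z).unique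
    (hasConstantTerm_trace_mul_mul (hσ l) (hσ' l) x y z)

theorem nTilde_congr (hρ : ∀ l, IsAfforded R L (ρ l)) (hσ : ∀ l, IsAfforded R L (σ l))
    (hρ' : ∀ l, IsBalanced R L (ρ l)) (hσ' : ∀ l, IsBalanced R L (σ l)) (w : W) :
    nTilde R L ρ w = nTilde R L σ w := by
  simp only [nTilde, ← Finset.mul_sum]
  refine Finset.sum_congr rfl fun l _ => congrArg _ ?_
  exact (hasConstantTerm_trace (hρ l) (hρ' l) w⁻¹).unique
    (hasConstantTerm_trace (hσ l) (hσ' l) w⁻¹)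

theorem jTilde_congr (hγ : ∀ x y z : W, gammaTilde R L ρ x y z = gammaTilde R L σ x y z)
    (hn : ∀ w : W, nTilde R L ρ w = nTilde R L σ w) : jTilde R L ρ = jTilde R L σ := by
  simp only [jTilde, hγ, hn]

end Families

end LeadingCoefficients

theorem proposition3p7
    {B W : Type*} [Group W] [Fintype W] {M : CoxeterMatrix B} {cs : CoxeterSystem M W}
    (R : Subring ℂ)
    (hR : ∀ i j : B,
      ((2 * Real.cos (2 * Real.pi / orderOf (cs.simple i * cs.simple j)) : ℝ) : ℂ) ∈ R)
    {Γ : Type*} [AddCommGroup Γ] [LinearOrder Γ] [IsOrderedAddMonoid Γ]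
    (L : cs.WeightFunction Γ) (hL : ∀ i : B, 0 < L (cs.simple i))
    {Λ : Type*} [Fintype Λ] (E : Λ → Type*) [∀ l, AddCommGroup (E l)]
    [∀ l, Module (LeadingCoefficients.LaurentField R Γ) (E l)]
    [∀ l, Module (LeadingCoefficients.HeckeK R L) (E l)]
    [∀ l, IsScalarTower (LeadingCoefficients.LaurentField R Γ)
      (LeadingCoefficients.HeckeK R L) (E l)]
    (hE : LeadingCoefficients.IsIrr R L E)
    (ρ σ : ∀ l, LeadingCoefficients.MatrixRep R L (E l))
    (hρ : ∀ l, LeadingCoefficients.IsAfforded R L (ρ l))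
    (hσ : ∀ l, LeadingCoefficients.IsAfforded R L (σ l))
    (hρ' : ∀ l, LeadingCoefficients.IsBalanced R L (ρ l))
    (hσ' : ∀ l, LeadingCoefficients.IsBalanced R L (σ l)) :
    (∀ x y z : W, LeadingCoefficients.gammaTilde R L ρ x y z =
      LeadingCoefficients.gammaTilde R L σ x y z) ∧
    (∀ w : W, LeadingCoefficients.nTilde R L ρ w = LeadingCoefficients.nTilde R L σ w) ∧
    LeadingCoefficients.jTilde R L ρ = LeadingCoefficients.jTilde R L σ := by
  have hγ := LeadingCoefficients.gammaTilde_congr hρ hσ hρ' hσ'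
  have hn := LeadingCoefficients.nTilde_congr hρ hσ hρ' hσ'
  exact ⟨hγ, hn, LeadingCoefficients.jTilde_congr hγ hn⟩
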